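/- Let $d\ge 1$ be an integer, let $h\in(0,1]$, and let $\alpha_1,\dots,\alpha_d\in(0,1)$. Let $\sigma(x)=x$ for $x\ge 0$ and $\sigma(x)=hx$ for $x<0$ be the leaky ReLU with constant $h$, applied to vectors entrywise. Then there are constants $c_1>0$ and $\rho^*>0$, depending only on $d$, $h$ and $\alpha_1,\dots,\alpha_d$, such that the following holds. Let $n_0,n_1,\dots,n_d$ be positive integers with $$\frac{n_i}{n_{i-1}}=\frac{1}{1-\alpha_i}\qquad(i=1,\dots,d),$$ and put $k=n_0$, $n=n_d$. Let $H_i\in\mathbb R^{n_i\times n_{i-1}}$ and $\boldsymbol\delta_i\in\mathbb R^{n_i}$ $(i=1,\dots,d)$ be random matrices and vectors on a common probability space such that each $H_i$ has i.i.d. $\mathcal N(0,1)$ entries and all the entries of $\boldsymbol\delta_1,\dots,\boldsymbol\delta_d$ are i.i.d. $\mathcal N(0,1)$ (independence between different weight matrices, or between the weights and the biases, is allowed but not required). Let $G:\mathbb R^k\to\mathbb R^n$ be the $d$-layer generator $$G(\mathbf z)=\sigma\bigl(H_d\,\sigma(H_{d-1}\cdots\sigma(H_1\mathbf z+\boldsymbol\delta_1)\cdots+\boldsymbol\delta_{d-1})+\boldsymbol\delta_d\bigr).$$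 Then, with probability at least $1-e^{-c_1 n}$, the following is true simultaneously for every $\mathbf z_0\in\mathbb R^k$ and every $\mathbf e\in\mathbb R^n$ with at most $\rho^* n$ nonzero entries: $\mathbf z=\mathbf z_0$ is the unique solution of the $\ell_1$-minimization problem $$\min_{\mathbf z\in\mathbb R^k}\ \bigl\|G(\mathbf z)-(G(\mathbf z_0)+\mathbf e)\bigr\|_1 .$$ -/

import Mathlib

open MeasureTheory ProbabilityTheory

noncomputable section

/-- The leaky ReLU with constant `h`: `x` if `x ≥ 0`, and `h * x` if `x < 0`. -/
def leakyReLU (h x : ℝ) : ℝ := if 0 ≤ x then x else h * x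

/-- The output of the first `i` layers of a `d`-layer leaky-ReLU network with layer widths
`n 0, …, n d`. The weight matrix `H i` and the bias `δ i` (`i = 0, …, d - 1`) lead from the layer
of width `n i` to the layer of width `n (i + 1)`, and the activation acts entrywise. -/
def layerOutput (h : ℝ) {d : ℕ} (n : Fin (d + 1) → ℕ)
    (H : (i : Fin d) → Matrix (Fin (n i.succ)) (Fin (n i.castSucc)) ℝ)
    (δ : (i : Fin d) → Fin (n i.succ) → ℝ) (i : Fin (d + 1)) :
    (Fin (n 0) → ℝ) → Fin (n i) → ℝ :=
  Fin.induction (motive := fun i => (Fin (n 0) → ℝ) → Fin (n i) → ℝ)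
    (fun z => z)
    (fun i f z j => leakyReLU h ((H i).mulVec (f z) j + δ i j)) i

/-- The generator: the output of all `d` layers. -/
def generator (h : ℝ) {d : ℕ} (n : Fin (d + 1) → ℕ)
    (H : (i : Fin d) → Matrix (Fin (n i.succ)) (Fin (n i.castSucc)) ℝ)
    (δ : (i : Fin d) → Fin (n i.succ) → ℝ) :
    (Fin (n 0) → ℝ) → Fin (n (Fin.last d)) → ℝ :=
  layerOutput h n H δ (Fin.last d)

/-- The `ℓ₁` norm of a vector. -/
def l1Norm {m : ℕ} (x : Fin m → ℝ) : ℝ := ∑ j, |x j|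

/-- `x` is the one and only global minimizer of `f`. -/
def IsUniqueMinimizer {X : Type*} (f : X → ℝ) (x : X) : Prop :=
  IsMinOn f Set.univ x ∧ ∀ y, IsMinOn f Set.univ y → y = x

/-- The random variables `X a` are i.i.d. with law `N(0, 1)`. -/
def IsIIDStdGaussian {ι Ω : Type*} [MeasurableSpace Ω] (X : ι → Ω → ℝ) (μ : Measure Ω) : Prop :=
  iIndepFun X μ ∧ ∀ a, HasLaw (X a) (gaussianReal 0 1) μ

end

theorem card_le_of_separated_of_norm_eq_one {k : ℕ} {ε : ℝ} (hε : 0 < ε) (hε1 : ε ≤ 1)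
    (s : Finset (EuclideanSpace ℝ (Fin k))) (hs : ∀ c ∈ s, ‖c‖ = 1)
    (h : ∀ c ∈ s, ∀ d ∈ s, c ≠ d → ε ≤ ‖c - d‖) : (s.card : ℝ) ≤ (3 / ε) ^ k := by
  have hinj : Set.InjOn (fun c : EuclideanSpace ℝ (Fin k) => (2 / ε) • c) s := fun a _ b _ hab =>
    smul_right_injective _ (by positivity : (2 / ε : ℝ) ≠ 0) hab
  let μ : Measure (EuclideanSpace ℝ (Fin k)) := volume
  have hdisj : Set.Pairwise (s : Set (EuclideanSpace ℝ (Fin k)))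
      (Function.onFun Disjoint fun c => Metric.ball c (ε / 2)) := fun c hc d hd hcd =>
    Metric.ball_disjoint_ball (by rw [dist_eq_norm]; linarith [h c hc d hd hcd])
  have hsub : (⋃ c ∈ s, Metric.ball c (ε / 2)) ⊆
      Metric.ball (0 : EuclideanSpace ℝ (Fin k)) (3 / 2) :=
    Set.iUnion₂_subset fun x hx => Metric.ball_subset_ball' (by
      rw [dist_zero_right, hs x hx]; linarith)
  have hvol : (s.card : ENNReal) * ENNReal.ofReal ((ε / 2) ^ k) * μ (Metric.ball 0 1) ≤
      ENNReal.ofReal ((3 / 2 : ℝ) ^ k) * μ (Metric.ball 0 1) := by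
    have hle := measure_mono (μ := μ) hsub
    rw [measure_biUnion_finset hdisj fun c _ => measurableSet_ball] at hle
    simpa [μ, Measure.addHaar_ball_of_pos _ _ (half_pos hε),
      Measure.addHaar_ball_of_pos _ (0 : EuclideanSpace ℝ (Fin k)) (by norm_num : (0 : ℝ) < 3 / 2),
      mul_assoc] using hle
  have hcard := ENNReal.toReal_le_of_le_ofReal (by positivity)
    ((ENNReal.mul_le_mul_iff_left (Metric.measure_ball_pos _ _ zero_lt_one).ne'
      measure_ball_lt_top.ne).1 hvol)
  rw [ENNReal.toReal_mul, ENNReal.toReal_natCast, ENNReal.toReal_ofReal (by positivity)] at hcard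
  rw [show (3 / ε) ^ k = (3 / 2 : ℝ) ^ k / (ε / 2) ^ k by rw [← div_pow]; congr 1; field_simp,
    le_div_iff₀ (by positivity)]
  exact hcard

theorem exists_sphere_net (k : ℕ) {ε : ℝ} (hε : 0 < ε) (hε1 : ε ≤ 1) :
    ∃ N : Finset (EuclideanSpace ℝ (Fin k)), (∀ y ∈ N, ‖y‖ = 1) ∧ (N.card : ℝ) ≤ (3 / ε) ^ k ∧
      ∀ x : EuclideanSpace ℝ (Fin k), ‖x‖ = 1 → ∃ y ∈ N, ‖x - y‖ ≤ ε := by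
  classical
  let P : Finset (EuclideanSpace ℝ (Fin k)) → Prop := fun s =>
    (∀ c ∈ s, ‖c‖ = 1) ∧ ∀ c ∈ s, ∀ d ∈ s, c ≠ d → ε ≤ ‖c - d‖
  have hbdd : BddAbove {n | ∃ s, P s ∧ s.card = n} := by
    refine ⟨⌊(3 / ε) ^ k⌋₊, ?_⟩
    rintro _ ⟨s, hs, rfl⟩
    exact Nat.le_floor (card_le_of_separated_of_norm_eq_one hε hε1 s hs.1 hs.2)
  obtain ⟨N, hN, hcard⟩ := Nat.sSup_mem (s := {n | ∃ s, P s ∧ s.card = n})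
    ⟨0, ∅, by simp [P], rfl⟩ hbdd
  refine ⟨N, hN.1, card_le_of_separated_of_norm_eq_one hε hε1 N hN.1 hN.2, fun x hx => ?_⟩
  by_contra! hfar
  have hxN : x ∉ N := fun hxN => by simpa [hε.not_gt] using hfar x hxN
  have hins : P (insert x N) := by
    refine ⟨fun c hc => ?_, fun c hc e he hce => ?_⟩
    · rcases Finset.mem_insert.1 hc with rfl | hc
      exacts [hx, hN.1 c hc]
    · rcases Finset.mem_insert.1 hc with hcx | hc <;> rcases Finset.mem_insert.1 he with hex | he
      · exact absurd (hcx.trans hex.symm) hce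
      · rw [hcx]; exact (hfar e he).le
      · rw [hex, norm_sub_rev]; exact (hfar c hc).le
      · exact hN.2 c hc e he hce
  have := le_csSup hbdd ⟨_, hins, rfl⟩
  rw [← hcard, Finset.card_insert_of_notMem hxN] at this
  omega

theorem lintegral_exp_sq_gaussianReal_le :
    ∫⁻ u, ENNReal.ofReal (Real.exp (u ^ 2 / 4)) ∂gaussianReal 0 1 ≤ ENNReal.ofReal 2 := by
  rw [gaussianReal_of_var_ne_zero _ one_ne_zero,
    lintegral_withDensity_eq_lintegral_mul _ (measurable_gaussianPDF _ _) (by fun_prop)]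
  have heq : ∀ u : ℝ, (gaussianPDF 0 1 * fun u => ENNReal.ofReal (Real.exp (u ^ 2 / 4))) u =
      ENNReal.ofReal ((√(2 * Real.pi))⁻¹ * Real.exp (-(1 / 4) * u ^ 2)) := fun u => by
    rw [Pi.mul_apply, gaussianPDF, ← ENNReal.ofReal_mul (gaussianPDFReal_nonneg _ _ _),
      gaussianPDFReal, mul_assoc, ← Real.exp_add]
    simp only [NNReal.coe_one, mul_one, sub_zero]
    congr 3; ring
  simp_rw [heq]
  rw [← ofReal_integral_eq_lintegral_ofReal
    ((integrable_exp_neg_mul_sq (by norm_num)).const_mul _)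
    (Filter.Eventually.of_forall fun u => by positivity), integral_const_mul, integral_gaussian]
  refine ENNReal.ofReal_le_ofReal ?_
  rw [inv_mul_le_iff₀ (by positivity), show (Real.pi / (1 / 4)) = 2 * (2 * Real.pi) by ring,
    Real.sqrt_mul (by norm_num)]
  have : √2 ≤ 2 := by rw [Real.sqrt_le_left (by norm_num)]; norm_num
  nlinarith [Real.sqrt_nonneg (2 * Real.pi)]

theorem lintegral_exp_neg_abs_gaussianReal_le {t : ℝ} (ht : 0 < t) :
    ∫⁻ u, ENNReal.ofReal (Real.exp (-|u| / t)) ∂gaussianReal 0 1 ≤ ENNReal.ofReal (2 * t) := by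
  rw [gaussianReal_of_var_ne_zero _ one_ne_zero,
    lintegral_withDensity_eq_lintegral_mul _ (measurable_gaussianPDF _ _) (by fun_prop)]
  have hexp : ∀ u : ℝ, Real.exp (-u / t) = Real.exp (-t⁻¹ * u) := fun u => by
    congr 1; field_simp
  have hneg : -t⁻¹ < 0 := by simpa using ht
  have hint : Integrable fun u : ℝ => Real.exp (-|u| / t) := by
    rw [← integrableOn_univ, ← Set.Iic_union_Ioi (a := (0 : ℝ))]
    refine IntegrableOn.union ?_ ?_
    · refine (integrableOn_exp_mul_Iic (inv_pos.2 ht) 0).congr_fun (fun u hu => ?_)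
        measurableSet_Iic
      rw [hexp, abs_of_nonpos hu, neg_mul_neg]
    · refine (integrableOn_exp_mul_Ioi hneg 0).congr_fun (fun u hu => ?_) measurableSet_Ioi
      rw [hexp, abs_of_pos hu]
  have hval : ∫ u : ℝ, Real.exp (-|u| / t) = 2 * t := by
    rw [integral_comp_abs (f := fun u => Real.exp (-u / t))]
    simp_rw [hexp]
    rw [integral_exp_mul_Ioi hneg]
    simp
  rw [← hval, ofReal_integral_eq_lintegral_ofReal hint
    (Filter.Eventually.of_forall fun u => by positivity)]
  refine lintegral_mono fun u => ?_
  rw [Pi.mul_apply, gaussianPDF, ← ENNReal.ofReal_mul (gaussianPDFReal_nonneg _ _ _)]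
  refine ENNReal.ofReal_le_ofReal (mul_le_of_le_one_left (by positivity) ?_)
  rw [gaussianPDFReal]
  refine mul_le_one₀ (inv_le_one_of_one_le₀ ?_) (by positivity) (Real.exp_le_one_iff.2 ?_)
  · rw [Real.one_le_sqrt, NNReal.coe_one]
    linarith [Real.pi_gt_three]
  · rw [neg_div]
    exact neg_nonpos.2 (by positivity)

theorem hasLaw_sum_mul_pi_gaussianReal {κ : Type*} [Fintype κ] {y : EuclideanSpace ℝ κ}
    (hy : ‖y‖ = 1) :
    HasLaw (fun x : κ → ℝ => ∑ l, x l * y l) (gaussianReal 0 1)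
      (Measure.pi fun _ => gaussianReal 0 1) where
  aemeasurable := Measurable.aemeasurable (by fun_prop)
  map_eq := by
    have hcomp : (fun x : κ → ℝ => ∑ l, x l * y l) = innerSL ℝ y ∘ WithLp.toLp 2 := by
      ext x
      simp [PiLp.inner_apply]
    rw [hcomp, ← Measure.map_map (by fun_prop) (by fun_prop), map_pi_eq_stdGaussian,
      IsGaussian.map_eq_gaussianReal, integral_strongDual_stdGaussian, variance_dual_stdGaussian]
    simp [hy]

theorem IsIIDStdGaussian.hasLaw_mulVec {ι κ Ω : Type*} [Fintype ι] [Fintype κ]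
    [MeasurableSpace Ω] {μ : Measure Ω} {X : ι × κ → Ω → ℝ} (hX : IsIIDStdGaussian X μ)
    {y : EuclideanSpace ℝ κ} (hy : ‖y‖ = 1) :
    HasLaw (fun ω j => ∑ l, X (j, l) ω * y l) (Measure.pi fun _ : ι => gaussianReal 0 1) μ := by
  have hcurry : HasLaw (MeasurableEquiv.curry ι κ ℝ)
      (Measure.pi fun _ : ι => Measure.pi fun _ : κ => gaussianReal 0 1)
      (Measure.pi fun _ : ι × κ => gaussianReal 0 1) := by
    refine ⟨by fun_prop, ?_⟩
    simpa only [Measure.infinitePi_eq_pi] using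
      Measure.infinitePi_map_curry (fun (_ : ι) (_ : κ) => gaussianReal 0 1)
  have hrow : HasLaw (fun (x : ι → κ → ℝ) j => ∑ l, x j l * y l)
      (Measure.pi fun _ : ι => gaussianReal 0 1)
      (Measure.pi fun _ : ι => Measure.pi fun _ : κ => gaussianReal 0 1) := by
    refine ⟨Measurable.aemeasurable (by fun_prop), ?_⟩
    rw [Measure.pi_map_pi fun _ => (hasLaw_sum_mul_pi_gaussianReal hy).aemeasurable]
    simp_rw [(hasLaw_sum_mul_pi_gaussianReal hy).map_eq]
  exact hrow.comp (hcurry.comp (hX.1.hasLaw_pi hX.2))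

theorem measure_le_prod_comp_le {m : ℕ} {Ω : Type*} [MeasurableSpace Ω] {μ : Measure Ω}
    {Z : Ω → Fin m → ℝ} {ν : Measure ℝ} [IsProbabilityMeasure ν]
    (hZ : HasLaw Z (Measure.pi fun _ => ν) μ) {F : ℝ → ENNReal}
    (hF : Measurable F) {K c : ℝ} (hK : 0 ≤ K) (hc : 0 < c)
    (hFK : ∫⁻ u, F u ∂ν ≤ ENNReal.ofReal K) :
    μ.real {ω | ENNReal.ofReal c ≤ ∏ j, F (Z ω j)} ≤ K ^ m / c := by
  have hprod : Measurable fun z : Fin m → ℝ => ∏ j, F (z j) :=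
    Finset.measurable_fun_prod _ fun j _ => hF.comp (measurable_pi_apply j)
  have hint : ∫⁻ ω, ∏ j, F (Z ω j) ∂μ ≤ ENNReal.ofReal (K ^ m) := by
    rw [hZ.lintegral_comp (f := fun z => ∏ j, F (z j)) hprod.aemeasurable,
      lintegral_prod_eq_prod_lintegral_of_indepFun Finset.univ (fun j (z : Fin m → ℝ) => F (z j))
        (iIndepFun_pi fun _ => hF.aemeasurable) (fun j => hF.comp (measurable_pi_apply j)), ENNReal.ofReal_pow hK]
    have : ∀ j : Fin m, ∫⁻ z : Fin m → ℝ, F (z j) ∂(Measure.pi fun _ => ν) = ∫⁻ u, F u ∂ν :=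
      fun j => (measurePreserving_eval (fun _ : Fin m => ν) j).lintegral_comp hF
    simp_rw [this]
    simpa using pow_le_pow_left₀ zero_le hFK m
  have hmeas : AEMeasurable (fun ω => ∏ j, F (Z ω j)) μ :=
    hprod.comp_aemeasurable hZ.aemeasurable
  refine ENNReal.toReal_le_of_le_ofReal (by positivity) ?_
  rw [ENNReal.ofReal_div_of_pos hc]
  exact (meas_ge_le_lintegral_div hmeas (by simpa using hc) ENNReal.ofReal_ne_top).trans
    (by gcongr)

theorem measureReal_sum_sq_ge_le {m : ℕ} {Ω : Type*} [MeasurableSpace Ω] {μ : Measure Ω}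
    {Z : Ω → Fin m → ℝ} (hZ : HasLaw Z (Measure.pi fun _ => gaussianReal 0 1) μ) (B : ℝ) :
    μ.real {ω | 4 * B * m ≤ ∑ j, Z ω j ^ 2} ≤ (2 * Real.exp (-B)) ^ m := by
  have h := measure_le_prod_comp_le hZ (F := fun u => ENNReal.ofReal (Real.exp (u ^ 2 / 4)))
    (by fun_prop) zero_le_two (Real.exp_pos (B * m)) lintegral_exp_sq_gaussianReal_le
  convert h using 1
  · congr 1
    ext ω
    simp only [Set.mem_ofPred_eq]
    rw [← ENNReal.ofReal_prod_of_nonneg fun _ _ => by positivity, ← Real.exp_sum,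
      ENNReal.ofReal_le_ofReal_iff (by positivity), Real.exp_le_exp, ← Finset.sum_div,
      le_div_iff₀ (by norm_num)]
    ring_nf
  · rw [mul_pow, ← Real.exp_nat_mul, div_eq_mul_inv, ← Real.exp_neg]
    ring_nf

theorem measureReal_sum_abs_le_le {m : ℕ} {Ω : Type*} [MeasurableSpace Ω] {μ : Measure Ω}
    {Z : Ω → Fin m → ℝ} (hZ : HasLaw Z (Measure.pi fun _ => gaussianReal 0 1) μ)
    {t : ℝ} (ht : 0 < t) :
    μ.real {ω | ∑ j, |Z ω j| ≤ t * m} ≤ (2 * t * Real.exp 1) ^ m := by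
  have h := measure_le_prod_comp_le hZ (F := fun u => ENNReal.ofReal (Real.exp (-|u| / t)))
    (by fun_prop) (by positivity : 0 ≤ 2 * t) (Real.exp_pos (-m))
    (lintegral_exp_neg_abs_gaussianReal_le ht)
  convert h using 1
  · congr 1
    ext ω
    simp only [Set.mem_ofPred_eq]
    rw [← ENNReal.ofReal_prod_of_nonneg fun _ _ => by positivity, ← Real.exp_sum,
      ENNReal.ofReal_le_ofReal_iff (by positivity), Real.exp_le_exp, ← Finset.sum_div,
      le_div_iff₀ ht, Finset.sum_neg_distrib, neg_mul, neg_le_neg_iff, mul_comm]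
  · rw [mul_pow, ← Real.exp_nat_mul, div_eq_mul_inv, ← Real.exp_neg]
    ring_nf

theorem sum_abs_le_sqrt_card_mul_norm {m : ℕ} (S : Finset (Fin m))
    (v : EuclideanSpace ℝ (Fin m)) : ∑ j ∈ S, |v j| ≤ √S.card * ‖v‖ := by
  rw [EuclideanSpace.norm_eq, ← Real.sqrt_mul (Nat.cast_nonneg _)]
  refine Real.le_sqrt_of_sq_le (sq_sum_le_card_mul_sum_sq.trans ?_)
  simp_rw [sq_abs, Real.norm_eq_abs, sq_abs]
  gcongr
  exact Finset.subset_univ S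

theorem ContinuousLinearMap.opNorm_le_of_half_net {E F : Type*} [NormedAddCommGroup E]
    [NormedSpace ℝ E] [NormedAddCommGroup F] [NormedSpace ℝ F] (A : E →L[ℝ] F) {N : Set E}
    {R : ℝ} (hR : 0 ≤ R) (hN : ∀ x : E, ‖x‖ = 1 → ∃ y ∈ N, ‖x - y‖ ≤ 1 / 2)
    (hA : ∀ y ∈ N, ‖A y‖ ≤ R) : ‖A‖ ≤ 2 * R := by
  have hle : ‖A‖ ≤ R + ‖A‖ * (1 / 2) := by
    refine A.opNorm_le_of_unit_norm (by positivity) fun x hx => ?_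
    obtain ⟨y, hy, hxy⟩ := hN x hx
    calc ‖A x‖ = ‖A y + A (x - y)‖ := by rw [← map_add, add_sub_cancel]
      _ ≤ ‖A y‖ + ‖A (x - y)‖ := norm_add_le _ _
      _ ≤ R + ‖A‖ * (1 / 2) := add_le_add (hA y hy) (A.le_opNorm_of_le hxy)
  linarith

theorem lt_sum_abs_of_net {E : Type*} [NormedAddCommGroup E] [NormedSpace ℝ E] {m : ℕ}
    (A : E →L[ℝ] EuclideanSpace ℝ (Fin m)) {N : Set E} {L ε t : ℝ} (hA : ‖A‖ ≤ L * √m)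
    (hε : L * ε ≤ t)
    (hN : ∀ x : E, ‖x‖ = 1 → ∃ y ∈ N, ‖x - y‖ ≤ ε)
    (hl : ∀ y ∈ N, 2 * t * m < ∑ j, |A y j|) {x : E} (hx : ‖x‖ = 1) :
    t * m < ∑ j, |A x j| := by
  obtain ⟨y, hy, hxy⟩ := hN x hx
  have htri : ∑ j, |A y j| ≤ ∑ j, |A x j| + ∑ j, |A (x - y) j| := by
    rw [← Finset.sum_add_distrib]
    refine Finset.sum_le_sum fun j _ => ?_
    have : A y j = A x j - A (x - y) j := by simp
    rw [this]
    exact abs_sub _ _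
  have hdiff : ∑ j, |A (x - y) j| ≤ t * m :=
    calc ∑ j, |A (x - y) j| ≤ √m * ‖A (x - y)‖ := by
          simpa using sum_abs_le_sqrt_card_mul_norm Finset.univ (A (x - y))
      _ ≤ √m * (L * √m * ε) := by
          gcongr
          exact (A.le_opNorm_of_le hxy).trans
            (mul_le_mul_of_nonneg_right hA ((norm_nonneg _).trans hxy))
      _ = L * ε * (√m * √m) := by ring
      _ ≤ t * m := by
          rw [Real.mul_self_sqrt (Nat.cast_nonneg _)]
          gcongr
  linarith [hl y hy]

/-- The `ℓ₁` mass of any nonzero vector in the range of `M` on a set of at most `s` coordinates is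
less than `h` times its mass on the complementary coordinates. -/
def HasSpreadRange {m k : ℕ} (h s : ℝ) (M : Matrix (Fin m) (Fin k) ℝ) : Prop :=
  ∀ x : Fin k → ℝ, x ≠ 0 → ∀ S : Finset (Fin m), (S.card : ℝ) ≤ s →
    ∑ j ∈ S, |M.mulVec x j| < h * ∑ j ∈ Sᶜ, |M.mulVec x j|

theorem hasSpreadRange_of_bounds {m k : ℕ} (hm : 0 < m) {h L t : ℝ} (h_pos : 0 < h)
    (h_le : h ≤ 1) (hL : 0 < L) (ht : 0 < t) (M : Matrix (Fin m) (Fin k) ℝ)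
    (hupper : ‖M.toEuclideanLin.toContinuousLinearMap‖ ≤ L * √m)
    (hlower : ∀ x : EuclideanSpace ℝ (Fin k), ‖x‖ = 1 →
      t * m < ∑ j, |M.toEuclideanLin.toContinuousLinearMap x j|) :
    HasSpreadRange h ((h * t / (4 * L)) ^ 2 * m) M := by
  set A := M.toEuclideanLin.toContinuousLinearMap
  have hunit : ∀ x : EuclideanSpace ℝ (Fin k), ‖x‖ = 1 → ∀ S : Finset (Fin m),
      (S.card : ℝ) ≤ (h * t / (4 * L)) ^ 2 * m →
        ∑ j ∈ S, |A x j| < h * ∑ j ∈ Sᶜ, |A x j| := by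
    intro x hx S hS
    have hsmall : ∑ j ∈ S, |A x j| ≤ h * t / 4 * m :=
      calc ∑ j ∈ S, |A x j| ≤ √S.card * ‖A x‖ := sum_abs_le_sqrt_card_mul_norm _ _
        _ ≤ (h * t / (4 * L) * √m) * (L * √m) := by
            gcongr
            · rw [Real.sqrt_le_left (by positivity), mul_pow, Real.sq_sqrt (Nat.cast_nonneg _)]
              exact hS
            · exact (A.unit_le_opNorm x hx.le).trans hupper
        _ = h * t / 4 * (√m * √m) := by field_simp
        _ = h * t / 4 * m := by rw [Real.mul_self_sqrt (Nat.cast_nonneg _)]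
    have hsum := Finset.sum_add_sum_compl S fun j => |A x j|
    have hS0 : 0 ≤ ∑ j ∈ S, |A x j| := by positivity
    have hpos : 0 < h * (t * m) := by positivity
    have := mul_lt_mul_of_pos_left (hlower x hx) h_pos
    rw [← hsum, mul_add] at this
    nlinarith [mul_le_mul_of_nonneg_right h_le hS0]
  intro x hx S hS
  have hx' : 0 < ‖WithLp.toLp 2 x‖ := norm_pos_iff.2 (by simpa using hx)
  have hval : ∀ j, |A (‖WithLp.toLp 2 x‖⁻¹ • WithLp.toLp 2 x) j| =
      ‖WithLp.toLp 2 x‖⁻¹ * |M.mulVec x j| := fun j => by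
    rw [map_smul, PiLp.smul_apply, smul_eq_mul, abs_mul, abs_of_pos (inv_pos.2 hx')]
    simp [A]
  have := hunit (‖WithLp.toLp 2 x‖⁻¹ • WithLp.toLp 2 x) (by
    rw [norm_smul, norm_inv, norm_norm, inv_mul_cancel₀ hx'.ne']) S hS
  simp_rw [hval, ← Finset.mul_sum] at this
  rw [mul_left_comm] at this
  exact lt_of_mul_lt_mul_left this (inv_pos.2 hx').le

theorem exists_pos_mul_rpow_le {a b c : ℝ} (ha : 0 < a) (hc : 0 < c) (hb : 0 < b) :
    ∃ t : ℝ, 0 < t ∧ t ≤ 1 ∧ t * (b / t) ^ (1 - a) ≤ c := by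
  have htend : Filter.Tendsto (fun t : ℝ => b ^ (1 - a) * t ^ a) (nhdsWithin 0 (Set.Ioi 0))
      (nhds 0) := by
    have := ((Real.continuousAt_rpow_const 0 a (Or.inr ha.le)).tendsto.const_mul (b ^ (1 - a)))
    rw [Real.zero_rpow ha.ne', mul_zero] at this
    exact this.mono_left nhdsWithin_le_nhds
  obtain ⟨t, htc, ht0, ht1⟩ := ((htend.eventually_le_const hc).and
    (Ioc_mem_nhdsGT zero_lt_one)).exists
  refine ⟨t, ht0, ht1, le_of_eq_of_le ?_ htc⟩
  rw [Real.div_rpow hb.le ht0.le, Real.rpow_sub ht0, Real.rpow_one]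
  field_simp

theorem exists_hasSpreadRange_constant {a h q : ℝ} (ha : 0 < a) (h_pos : 0 < h)
    (h_le : h ≤ 1) (hq : 0 < q) :
    ∃ ρ : ℝ, 0 < ρ ∧ ∀ m k : ℕ, 0 < m → (k : ℝ) = (1 - a) * m →
      ∀ (Ω : Type*) [MeasurableSpace Ω] (μ : Measure Ω) [IsProbabilityMeasure μ]
        (H : Ω → Matrix (Fin m) (Fin k) ℝ),
        IsIIDStdGaussian (fun (p : Fin m × Fin k) ω => H ω p.1 p.2) μ →
        μ.real {ω | ¬ HasSpreadRange h (ρ * m) (H ω)} ≤ q ^ m := by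
  obtain ⟨B, hB1, hB⟩ : ∃ B : ℝ, 1 ≤ B ∧ 12 * Real.exp (-B) ≤ q / 2 := by
    refine ⟨max 1 (-Real.log (q / 24)), le_max_left _ _, ?_⟩
    have : Real.exp (-max 1 (-Real.log (q / 24))) ≤ q / 24 := by
      rw [← Real.le_log_iff_exp_le (by positivity)]
      linarith [le_max_right 1 (-Real.log (q / 24))]
    linarith
  set L := 2 * √(4 * B)
  have hsqrt : 1 ≤ √(4 * B) := Real.one_le_sqrt.2 (by linarith)
  have hL1 : 1 ≤ L := by simp only [L]; linarith
  have hL : 0 < L := by linarith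
  obtain ⟨t, ht0, ht1, ht⟩ := exists_pos_mul_rpow_le ha
    (show 0 < q / 2 / (4 * Real.exp 1) by positivity) (show 0 < 3 * L by positivity)
  refine ⟨(h * t / (4 * L)) ^ 2, by positivity, fun m k hm hk Ω _ μ _ H hH => ?_⟩
  obtain ⟨N₁, hN₁, hcard₁, hnet₁⟩ :=
    exists_sphere_net k (show (0 : ℝ) < 1 / 2 by norm_num) (by norm_num)
  obtain ⟨N₂, hN₂, hcard₂, hnet₂⟩ := exists_sphere_net k (show 0 < t / L by positivity)
    ((div_le_one hL).2 (ht1.trans hL1))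
  have hkm : k ≤ m := by
    have : (k : ℝ) ≤ m := by rw [hk]; nlinarith [(Nat.cast_nonneg m : (0 : ℝ) ≤ m)]
    exact_mod_cast this
  let Z : EuclideanSpace ℝ (Fin k) → Ω → Fin m → ℝ := fun y ω j => ∑ l, H ω j l * y l
  have hZ : ∀ y ω j, (H ω).toEuclideanLin.toContinuousLinearMap y j = Z y ω j := fun y ω j => by
    simp [Z, Matrix.mulVec, dotProduct]
  have hsub : {ω | ¬ HasSpreadRange h ((h * t / (4 * L)) ^ 2 * m) (H ω)} ⊆
      (⋃ y ∈ N₁, {ω | 4 * B * m ≤ ∑ j, Z y ω j ^ 2}) ∪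
        ⋃ y ∈ N₂, {ω | ∑ j, |Z y ω j| ≤ 2 * t * m} := by
    intro ω hω
    by_contra hnot
    simp only [Set.mem_union, Set.mem_iUnion, Set.mem_ofPred_eq, not_or, not_exists, not_le]
      at hnot
    have hupper : ‖(H ω).toEuclideanLin.toContinuousLinearMap‖ ≤ L * √m := by
      have := ContinuousLinearMap.opNorm_le_of_half_net
        (H ω).toEuclideanLin.toContinuousLinearMap (N := N₁) (R := √(4 * B * m))
        (by positivity) hnet₁ fun y hy => by
          rw [EuclideanSpace.norm_eq]
          refine Real.sqrt_le_sqrt ?_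
          simp_rw [hZ, Real.norm_eq_abs, sq_abs]
          exact (hnot.1 y hy).le
      rwa [Real.sqrt_mul (by positivity), ← mul_assoc] at this
    refine hω (hasSpreadRange_of_bounds hm h_pos h_le hL ht0 _ hupper fun x hx => ?_)
    refine lt_sum_abs_of_net _ (N := N₂) hupper (mul_div_cancel₀ t hL.ne').le hnet₂
      (fun y hy => ?_) hx
    simp_rw [hZ]
    exact hnot.2 y hy
  have hbound₁ : μ.real (⋃ y ∈ N₁, {ω | 4 * B * m ≤ ∑ j, Z y ω j ^ 2}) ≤ (q / 2) ^ m :=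
    calc _ ≤ ∑ y ∈ N₁, μ.real {ω | 4 * B * m ≤ ∑ j, Z y ω j ^ 2} :=
          measureReal_biUnion_finset_le _ _
      _ ≤ ∑ y ∈ N₁, (2 * Real.exp (-B)) ^ m := Finset.sum_le_sum fun y hy =>
          measureReal_sum_sq_ge_le (hH.hasLaw_mulVec (hN₁ y hy)) B
      _ ≤ (3 / (1 / 2)) ^ m * (2 * Real.exp (-B)) ^ m := by
          rw [Finset.sum_const, nsmul_eq_mul]
          gcongr
          exact hcard₁.trans (pow_le_pow_right₀ (by norm_num) hkm)
      _ = (12 * Real.exp (-B)) ^ m := by rw [← mul_pow]; ring_nf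
      _ ≤ (q / 2) ^ m := by gcongr
  have hbound₂ : μ.real (⋃ y ∈ N₂, {ω | ∑ j, |Z y ω j| ≤ 2 * t * m}) ≤ (q / 2) ^ m :=
    calc _ ≤ ∑ y ∈ N₂, μ.real {ω | ∑ j, |Z y ω j| ≤ 2 * t * m} :=
          measureReal_biUnion_finset_le _ _
      _ ≤ ∑ y ∈ N₂, (2 * (2 * t) * Real.exp 1) ^ m := Finset.sum_le_sum fun y hy =>
          measureReal_sum_abs_le_le (hH.hasLaw_mulVec (hN₂ y hy)) (by positivity)
      _ ≤ (3 / (t / L)) ^ k * (2 * (2 * t) * Real.exp 1) ^ m := by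
          rw [Finset.sum_const, nsmul_eq_mul]
          gcongr
      _ = (4 * Real.exp 1 * (t * (3 * L / t) ^ (1 - a))) ^ m := by
          rw [← Real.rpow_natCast (3 / (t / L)) k, hk, Real.rpow_mul (by positivity),
            Real.rpow_natCast, ← mul_pow, div_div_eq_mul_div]
          ring_nf
      _ ≤ (q / 2) ^ m := by
          gcongr
          rwa [mul_comm, ← le_div_iff₀ (by positivity)]
  calc _ ≤ _ := measureReal_mono hsub
    _ ≤ (q / 2) ^ m + (q / 2) ^ m := (measureReal_union_le _ _).trans (add_le_add hbound₁ hbound₂)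
    _ = 2 * q ^ m / 2 ^ m := by rw [div_pow]; ring
    _ ≤ q ^ m := by
        rw [div_le_iff₀ (by positivity), mul_comm]
        gcongr
        exact le_self_pow₀ one_le_two hm.ne'

theorem mul_abs_sub_le_abs_leakyReLU_sub {h : ℝ} (h_le : h ≤ 1) (a b : ℝ) :
    h * |a - b| ≤ |leakyReLU h a - leakyReLU h b| := by
  wlog hab : b ≤ a generalizing a b
  · rw [abs_sub_comm, abs_sub_comm (leakyReLU h a)]
    exact this b a (le_of_not_ge hab)
  rw [abs_of_nonneg (sub_nonneg.2 hab)]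
  refine le_trans ?_ (le_abs_self _)
  unfold leakyReLU
  split_ifs <;> nlinarith

theorem abs_leakyReLU_sub_le {h : ℝ} (h_pos : 0 < h) (h_le : h ≤ 1) (a b : ℝ) :
    |leakyReLU h a - leakyReLU h b| ≤ |a - b| := by
  wlog hab : b ≤ a generalizing a b
  · rw [abs_sub_comm, abs_sub_comm a]
    exact this b a (le_of_not_ge hab)
  rw [abs_of_nonneg (sub_nonneg.2 hab), abs_le]
  unfold leakyReLU
  constructor <;> split_ifs <;> nlinarith

theorem leakyReLU_injective {h : ℝ} (h_pos : 0 < h) (h_le : h ≤ 1) :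
    Function.Injective (leakyReLU h) := fun a b hab => by
  have := mul_abs_sub_le_abs_leakyReLU_sub h_le a b
  rw [hab, sub_self, abs_zero] at this
  exact sub_eq_zero.1 (abs_nonpos_iff.1 (nonpos_of_mul_nonpos_right this h_pos))

theorem layerOutput_succ (h : ℝ) {d : ℕ} (n : Fin (d + 1) → ℕ)
    (H : (i : Fin d) → Matrix (Fin (n i.succ)) (Fin (n i.castSucc)) ℝ)
    (δ : (i : Fin d) → Fin (n i.succ) → ℝ) (i : Fin d) (z : Fin (n 0) → ℝ) :
    layerOutput h n H δ i.succ z =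
      fun j => leakyReLU h ((H i).mulVec (layerOutput h n H δ i.castSucc z) j + δ i j) := by
  simp only [layerOutput, Fin.induction_succ]

theorem HasSpreadRange.mulVec_injective {m k : ℕ} {h s : ℝ} {M : Matrix (Fin m) (Fin k) ℝ}
    (hM : HasSpreadRange h s M) (hs : 0 ≤ s) : Function.Injective M.mulVec := fun x y hxy => by
  by_contra hne
  have := hM (x - y) (sub_ne_zero.2 hne) ∅ (by simpa using hs)
  simp [Matrix.mulVec_sub, hxy] at this

theorem layerOutput_injective {h : ℝ} (h_pos : 0 < h) (h_le : h ≤ 1) {d : ℕ}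
    (n : Fin (d + 1) → ℕ)
    (H : (i : Fin d) → Matrix (Fin (n i.succ)) (Fin (n i.castSucc)) ℝ)
    (δ : (i : Fin d) → Fin (n i.succ) → ℝ) (hH : ∀ i, Function.Injective (H i).mulVec)
    (i : Fin (d + 1)) : Function.Injective (layerOutput h n H δ i) := by
  induction i using Fin.induction with
  | zero => exact fun x y hxy => by simpa [layerOutput] using hxy
  | succ i ih =>
    intro x y hxy
    rw [layerOutput_succ, layerOutput_succ] at hxy
    refine ih (hH i (funext fun j => ?_))
    exact add_right_cancel (leakyReLU_injective h_pos h_le (congrFun hxy j))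

theorem HasSpreadRange.l1Norm_lt {m k : ℕ} {h s : ℝ} (h_pos : 0 < h) (h_le : h ≤ 1)
    {M : Matrix (Fin m) (Fin k) ℝ} (hM : HasSpreadRange h s M) {x y : Fin k → ℝ} (hxy : x ≠ y)
    (b e : Fin m → ℝ) (he : (hammingNorm e : ℝ) ≤ s) :
    l1Norm e < l1Norm ((fun j => leakyReLU h (M.mulVec x j + b j)) -
      ((fun j => leakyReLU h (M.mulVec y j + b j)) + e)) := by
  set S : Finset (Fin m) := {j | e j ≠ 0}
  have hspread := hM (x - y) (sub_ne_zero.2 hxy) S he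
  rw [Finset.mul_sum] at hspread
  have hsub : ∀ j, M.mulVec (x - y) j = (M.mulVec x j + b j) - (M.mulVec y j + b j) := fun j => by
    rw [Matrix.mulVec_sub, Pi.sub_apply]; ring
  simp_rw [hsub] at hspread
  unfold l1Norm
  rw [← Finset.sum_add_sum_compl S, ← Finset.sum_add_sum_compl S fun j => |(_ : Fin m → ℝ) j|]
  have hout : ∑ j ∈ Sᶜ, |e j| = 0 := Finset.sum_eq_zero fun j hj => by
    simpa [S] using hj
  have hin : ∑ j ∈ S, |e j| ≤ ∑ j ∈ S, |leakyReLU h (M.mulVec x j + b j) -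
      (leakyReLU h (M.mulVec y j + b j) + e j)| +
      ∑ j ∈ S, |(M.mulVec x j + b j) - (M.mulVec y j + b j)| := by
    rw [← Finset.sum_add_distrib]
    refine Finset.sum_le_sum fun j _ => ?_
    refine le_trans ?_ (add_le_add_right (abs_leakyReLU_sub_le h_pos h_le _ _) _)
    rw [← sub_sub, abs_sub_comm _ (e j), add_comm]
    linarith [abs_sub_abs_le_abs_sub (e j)
      (leakyReLU h (M.mulVec x j + b j) - leakyReLU h (M.mulVec y j + b j))]
  have hcompl : ∑ j ∈ Sᶜ, h * |(M.mulVec x j + b j) - (M.mulVec y j + b j)| ≤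
      ∑ j ∈ Sᶜ, |leakyReLU h (M.mulVec x j + b j) -
        (leakyReLU h (M.mulVec y j + b j) + e j)| := by
    refine Finset.sum_le_sum fun j hj => ?_
    have hej : e j = 0 := by simpa [S] using hj
    rw [hej, add_zero]
    exact mul_abs_sub_le_abs_leakyReLU_sub h_le _ _
  simp only [Pi.sub_apply, Pi.add_apply]
  linarith

theorem isUniqueMinimizer_of_forall_lt {X : Type*} {f : X → ℝ} {x : X}
    (hf : ∀ y, y ≠ x → f x < f y) : IsUniqueMinimizer f x := by
  refine ⟨fun y _ => ?_, fun y hy => ?_⟩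
  · rcases eq_or_ne y x with rfl | hne
    exacts [le_refl (f y), (hf y hne).le]
  · by_contra hne
    exact (hf y hne).not_ge (hy (Set.mem_univ x))

theorem generator_isUniqueMinimizer {h : ℝ} (h_pos : 0 < h) (h_le : h ≤ 1) {d : ℕ}
    (n : Fin (d + 2) → ℕ)
    (H : (i : Fin (d + 1)) → Matrix (Fin (n i.succ)) (Fin (n i.castSucc)) ℝ)
    (δ : (i : Fin (d + 1)) → Fin (n i.succ) → ℝ) {s : Fin (d + 1) → ℝ} (hs : ∀ i, 0 ≤ s i)
    (hH : ∀ i, HasSpreadRange h (s i) (H i)) (z₀ : Fin (n 0) → ℝ)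
    (e : Fin (n (Fin.last (d + 1))) → ℝ) (he : (hammingNorm e : ℝ) ≤ s (Fin.last d)) :
    IsUniqueMinimizer (fun z : Fin (n 0) → ℝ =>
      l1Norm (generator h n H δ z - (generator h n H δ z₀ + e))) z₀ := by
  have hinj := layerOutput_injective h_pos h_le n H δ fun i => (hH i).mulVec_injective (hs i)
  have hlast : ∀ z, generator h n H δ z = fun j => leakyReLU h ((H (Fin.last d)).mulVec
      (layerOutput h n H δ (Fin.last d).castSucc z) j + δ (Fin.last d) j) :=
    layerOutput_succ h n H δ (Fin.last d)
  refine isUniqueMinimizer_of_forall_lt fun z hz => ?_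
  have hz₀ : l1Norm (generator h n H δ z₀ - (generator h n H δ z₀ + e)) = l1Norm e := by
    simp [l1Norm]
  rw [hz₀, hlast z, hlast z₀]
  exact (hH (Fin.last d)).l1Norm_lt h_pos h_le ((hinj _).ne hz) _ e he

theorem exists_pos_mul_last_le_width {d : ℕ} {α : Fin d → ℝ} (hα : ∀ i, α i < 1) :
    ∃ β : ℝ, 0 < β ∧ ∀ n : Fin (d + 1) → ℕ,
      (∀ i : Fin d, (n i.castSucc : ℝ) = (1 - α i) * n i.succ) →
      ∀ i, β * n (Fin.last d) ≤ n i := by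
  have hi : ∀ i : Fin (d + 1), ∃ β : ℝ, 0 < β ∧ ∀ n : Fin (d + 1) → ℕ,
      (∀ i : Fin d, (n i.castSucc : ℝ) = (1 - α i) * n i.succ) →
      β * n (Fin.last d) ≤ n i := by
    intro i
    induction i using Fin.reverseInduction with
    | last => exact ⟨1, one_pos, fun n _ => (one_mul _).le⟩
    | cast i ih =>
      obtain ⟨β, hβ, hle⟩ := ih
      have hi : 0 < 1 - α i := sub_pos.2 (hα i)
      refine ⟨(1 - α i) * β, by positivity, fun n hn => ?_⟩
      rw [hn i, mul_assoc]
      exact mul_le_mul_of_nonneg_left (hle n hn) hi.le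
  choose β hβ hle using hi
  obtain ⟨i₀, hi₀⟩ := Finite.exists_min β
  exact ⟨β i₀, hβ i₀, fun n hn i =>
    (mul_le_mul_of_nonneg_right (hi₀ i) (Nat.cast_nonneg _)).trans (hle i n hn)⟩

theorem mainTheorem1 (d : ℕ) (hd : 1 ≤ d) (h : ℝ) (h_pos : 0 < h) (h_le : h ≤ 1)
    (α : Fin d → ℝ) (hα : ∀ i, 0 < α i ∧ α i < 1) :
    ∃ c₁ : ℝ, 0 < c₁ ∧ ∃ ρ : ℝ, 0 < ρ ∧
      ∀ n : Fin (d + 1) → ℕ,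
        (∀ i : Fin d, (n i.succ : ℝ) / (n i.castSucc : ℝ) = 1 / (1 - α i)) →
      ∀ (Ω : Type*) [MeasurableSpace Ω] (μ : Measure Ω) [IsProbabilityMeasure μ]
        (H : (i : Fin d) → Ω → Matrix (Fin (n i.succ)) (Fin (n i.castSucc)) ℝ)
        (δ : (i : Fin d) → Ω → Fin (n i.succ) → ℝ),
        (∀ i : Fin d, IsIIDStdGaussian
          (fun (p : Fin (n i.succ) × Fin (n i.castSucc)) (ω : Ω) => H i ω p.1 p.2) μ) →
        IsIIDStdGaussian (fun (p : (i : Fin d) × Fin (n i.succ)) (ω : Ω) => δ p.1 ω p.2) μ →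
        ∃ A : Set Ω, MeasurableSet A ∧
          1 - Real.exp (-c₁ * (n (Fin.last d) : ℝ)) ≤ μ.real A ∧
          ∀ ω ∈ A, ∀ (z₀ : Fin (n 0) → ℝ) (e : Fin (n (Fin.last d)) → ℝ),
            (hammingNorm e : ℝ) ≤ ρ * (n (Fin.last d) : ℝ) →
            IsUniqueMinimizer
              (fun z : Fin (n 0) → ℝ =>
                l1Norm (generator h n (fun i => H i ω) (fun i => δ i ω) z -
                  (generator h n (fun i => H i ω) (fun i => δ i ω) z₀ + e))) z₀ := by
  obtain ⟨d, rfl⟩ : ∃ d', d = d' + 1 := ⟨d - 1, by omega⟩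
  obtain ⟨β, hβ, hwidth⟩ := exists_pos_mul_last_le_width fun i => (hα i).2
  set r : ℝ := 1 / (d + 2)
  have hr : 0 < r := by positivity
  have hr1 : r < 1 := by
    rw [div_lt_one (by positivity)]
    linarith [(Nat.cast_nonneg d : (0 : ℝ) ≤ d)]
  have hdr : (d + 1 : ℕ) * r ≤ 1 := by
    rw [mul_one_div, div_le_one (by positivity)]
    push_cast
    linarith
  choose ρ hρ hlayer using fun i =>
    exists_hasSpreadRange_constant (hα i).1 h_pos h_le (sq_pos_of_pos hr)
  refine ⟨-(β * Real.log r), by nlinarith [Real.log_neg hr hr1], ρ (Fin.last d),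
    hρ _, fun n hn Ω _ μ _ H δ hH _ => ?_⟩
  have hratio : ∀ i : Fin (d + 1), (n i.castSucc : ℝ) = (1 - α i) * n i.succ ∧ 0 < n i.succ := by
    intro i
    have hi : 0 < 1 - α i := sub_pos.2 (hα i).2
    have hpos : 0 < (n i.succ : ℝ) / n i.castSucc := by rw [hn i]; positivity
    have hc : (n i.castSucc : ℝ) ≠ 0 := fun h0 => by simp [h0] at hpos
    have hs : n i.succ ≠ 0 := fun h0 => by simp [h0] at hpos
    have := hn i
    rw [div_eq_div_iff hc hi.ne'] at this
    exact ⟨by linarith, Nat.pos_of_ne_zero hs⟩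
  set N := n (Fin.last (d + 1))
  set bad : Set Ω := ⋃ i, {ω | ¬ HasSpreadRange h (ρ i * n i.succ) (H i ω)}
  have hbad : μ.real bad ≤ Real.exp (-(-(β * Real.log r)) * N) :=
    calc μ.real bad ≤ ∑ i, μ.real {ω | ¬ HasSpreadRange h (ρ i * n i.succ) (H i ω)} :=
          measureReal_iUnion_fintype_le _
      _ ≤ ∑ _i : Fin (d + 1), r * r ^ (β * N) := by
          refine Finset.sum_le_sum fun i _ => ?_
          refine (hlayer i _ _ (hratio i).2 (hratio i).1 Ω μ (H i) (hH i)).trans ?_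
          rw [← pow_mul, two_mul, pow_add]
          refine mul_le_mul (pow_le_of_le_one hr.le hr1.le (hratio i).2.ne') ?_
            (by positivity) hr.le
          rw [← Real.rpow_natCast]
          exact Real.rpow_le_rpow_of_exponent_ge hr hr1.le
            (hwidth n (fun i => (hratio i).1) i.succ)
      _ = ((d + 1 : ℕ) * r) * r ^ (β * N) := by
          rw [Finset.sum_const, Finset.card_univ, Fintype.card_fin, nsmul_eq_mul, mul_assoc]
      _ ≤ r ^ (β * N) := mul_le_of_le_one_left (by positivity) hdr
      _ = Real.exp (-(-(β * Real.log r)) * N) := by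
          rw [Real.rpow_def_of_pos hr]
          ring_nf
  refine ⟨(toMeasurable μ bad)ᶜ, (measurableSet_toMeasurable _ _).compl, ?_,
    fun ω hω z₀ e he => ?_⟩
  · rw [probReal_compl_eq_one_sub (measurableSet_toMeasurable _ _), measureReal_def,
      measure_toMeasurable, ← measureReal_def]
    linarith
  · have hω' : ω ∉ bad := fun hmem => hω (subset_toMeasurable μ bad hmem)
    simp only [bad, Set.mem_iUnion, Set.mem_ofPred_eq, not_exists, not_not] at hω'
    exact generator_isUniqueMinimizer h_pos h_le n _ _
      (fun i => mul_nonneg (hρ i).le (Nat.cast_nonneg _)) hω' z₀ e he
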